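/- **Theorem 1.** Let $G=(V,E)$ be any (simple, undirected) graph, finite or infinite, connected or not. *The 1-complex.* Write $G$ also for the 1-complex of $G$: its points are the vertices of $G$ and, for every edge $e$, the points of a copy $\mathring e$ of the open interval $(0,1)$ (the *inner points* of $e$), so that $e=xy$ together with its endvertices becomes a copy of $[0,1]$; a set is open if and only if its trace on every closed edge is open in this copy of $[0,1]$. (So a vertex $v$ has as basic open neighbourhoods the unions of half-open intervals $[v,i_e)$, one for each edge $e$ at $v$, with arbitrary inner points $i_e$ of $e$.) *Tangles.* A (finite order) oriented separation of $G$ is a pair $(A,B)$ of vertex sets with $A\cup B=V$ and $A\cap B$ finite such that $G$ has no edge between $A\setminus B$ and $B\setminus A$. Put $(A,B)\le(C,D)$ if $A\subseteq C$ and $B\supseteq D$. An *orientation* is a set $O$ of oriented separations that contains precisely one of $(A,B)$ and $(B,A)$ for every separation $\{A,B\}$. It is *consistent* if no two distinct $(B,A),(C,D)\in O$ satisfy $(A,B)<(C,D)$. A *star* is a set $\sigma$ of oriented separations such that $(A,B)\le (D,C)$ for all distinct $(A,B),(C,D)\in\sigma$; its *interior* is $\bigcap_{(A,B)\in\sigma}B$.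 An *$\aleph_0$-tangle* is a consistent orientation that contains no finite star of finite interior as a subset. Let $\Theta$ be the set of all $\aleph_0$-tangles of $G$. *The tangle compactification.* For a finite set $X\subseteq V$ let $\mathcal C_X$ be the set of components of $G-X$, and for $\mathcal C\subseteq\mathcal C_X$ let $V[\mathcal C]$ be the union of their vertex sets. For a tangle $\tau$ put $U(\tau,X)=\{\mathcal C\subseteq\mathcal C_X : (V\setminus V[\mathcal C],\,X\cup V[\mathcal C])\in\tau\}$. The tangle compactification $|G|_\Theta$ is the set $G\sqcup\Theta$ with the topology generated by the open sets of the 1-complex $G$ and, for all finite $X\subseteq V$ and all $\mathcal C\subseteq\mathcal C_X$, the sets $$\mathcal O(X,\mathcal C)=\bigcup\mathcal C\;\cup\;\mathring E\big(X,\textstyle\bigcup\mathcal C\big)\;\cup\;\{\tau\in\Theta : \mathcal C\in U(\tau,X)\},$$ where $\bigcup\mathcal C$ consists of the points of the 1-complexes of the components in $\mathcal C$, and $\mathring E(X,\bigcup\mathcal C)$ of the inner points of all edges between $X$ and $V[\mathcal C]$. *The result.* Let $\beta G\supseteq G$ be the Stone–Čech compactification of the 1-complex $G$ and $G^*=\beta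 G\setminus G$ its remainder, with the subspace topology of $\beta G$. Let $\tau'$ be the topology on the set $\beta G$ that is generated by the open sets of $\beta G$ together with the set $G$, and let $\approx_*$ be the equivalence relation on $\beta G$ whose classes are the connected components of $G^*$ and the singletons $\{p\}$ with $p\in G$. Then there is a homeomorphism from the quotient space $(\beta G,\tau')/{\approx_*}$ to the tangle compactification $|G|_\Theta$ that is the identity on $G$. -/

import Mathlib

open Set

noncomputable section

namespace SimpleGraph

universe u

variable {V : Type u}

/-! ### The 1-complex of a graph -/

/-- The point set of the 1-complex of `G`: the vertices of `G`, and for every edge `e` a copy of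
the open unit interval (the inner edge points of `e`). -/
inductive OneComplex (G : SimpleGraph V) : Type u
  | vertex (v : V) : OneComplex G
  | inner (e : G.edgeSet) (t : Ioo (0 : ℝ) 1) : OneComplex G

namespace OneComplex

variable {G : SimpleGraph V}

open scoped Classical in
/-- The parametrisation of the topological edge `e` by the closed unit interval. Here `0` and `1`
are sent to the two endvertices of `e` (an arbitrary order of these has been chosen), and interior
parameters to the inner edge points of `e`. -/
def edgeMap (e : G.edgeSet) (t : Icc (0 : ℝ) 1) : G.OneComplex :=
  if h : (t : ℝ) ∈ Ioo (0 : ℝ) 1 then inner e ⟨t, h⟩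
  else if (t : ℝ) = 0 then vertex (Quot.out (e : Sym2 V)).1
  else vertex (Quot.out (e : Sym2 V)).2

/-- The topology of the 1-complex: a set is open if and only if its preimage in every closed
edge `[0, 1]` is open. So a basic neighbourhood of a vertex is a union of half-open
partial edges `[v, i_e)`, one for each edge `e` at `v`, where the lengths of these may be chosen
independently of each other. -/
instance : TopologicalSpace G.OneComplex :=
  ⨆ e : G.edgeSet, TopologicalSpace.coinduced (edgeMap e) inferInstance

theorem isOpen_iff (U : Set G.OneComplex) : IsOpen U ↔ ∀ e, IsOpen (edgeMap e ⁻¹' U) := by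
  unfold instTopologicalSpace
  simp only [isOpen_iSup_iff, isOpen_coinduced]

end OneComplex

/-! ### Finite order separations and tangles -/

/-- The pair `s = (A, B)` is an oriented separation of `G` of finite order. -/
def IsSeparation (G : SimpleGraph V) (s : Set V × Set V) : Prop :=
  (s.1 ∩ s.2).Finite ∧ s.1 ∪ s.2 = univ ∧ ∀ a ∈ s.1 \ s.2, ∀ b ∈ s.2 \ s.1, ¬ G.Adj a b

/-- The partial order on oriented separations: `(A, B) ≤ (C, D)` if `A ⊆ C` and `B ⊇ D`. -/
def SepLE (s t : Set V × Set V) : Prop :=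
  s.1 ⊆ t.1 ∧ t.2 ⊆ s.2

/-- `O` is an orientation of the set of all finite order separations of `G`: it contains precisely
one of the (possibly equal) pairs `(A, B)` and `(B, A)` for every such separation `{A, B}`. -/
def IsOrientation (G : SimpleGraph V) (O : Set (Set V × Set V)) : Prop :=
  (∀ s ∈ O, G.IsSeparation s) ∧
    ∀ s, G.IsSeparation s → (s ∈ O ∨ s.swap ∈ O) ∧ (s ∈ O → s.swap ∈ O → s = s.swap)

/-- No two distinct elements `(B, A)` and `(C, D)` of `O` satisfy `(A, B) < (C, D)`. -/
def IsConsistent (O : Set (Set V × Set V)) : Prop :=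
  ∀ r ∈ O, ∀ s ∈ O, r ≠ s → ¬ (SepLE r.swap s ∧ r.swap ≠ s)

/-- Every two distinct elements of `σ` point towards each other. -/
def IsStar (σ : Set (Set V × Set V)) : Prop :=
  ∀ r ∈ σ, ∀ s ∈ σ, r ≠ s → SepLE r s.swap

/-- The interior of a star: the intersection of its big sides. -/
def starInterior (σ : Set (Set V × Set V)) : Set V :=
  ⋂ r ∈ σ, r.2

/-- An `ℵ₀`-tangle of `G`: a consistent orientation of the set of finite order separations of `G`
that contains no finite star of finite interior as a subset. -/
@[ext]
structure Tangle (G : SimpleGraph V) where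
  /-- The oriented separations that belong to the tangle. -/
  seps : Set (Set V × Set V)
  isOrientation : G.IsOrientation seps
  isConsistent : IsConsistent seps
  not_finite_star : ∀ σ ⊆ seps, σ.Finite → IsStar σ → ¬ (starInterior σ).Finite

/-- `V[𝒞]`, the set of the vertices of the components in `𝒞`, for a set `𝒞` of components
of `G - X`. -/
def compVerts {G : SimpleGraph V} {X : Set V} (𝒞 : Set (G.ComponentCompl X)) : Set V :=
  ⋃ C ∈ 𝒞, (C : Set V)

/-- The oriented separation `(V \ V[𝒞], X ∪ V[𝒞])`. -/
def sepTowards {G : SimpleGraph V} {X : Set V} (𝒞 : Set (G.ComponentCompl X)) :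
    Set V × Set V :=
  ((compVerts 𝒞)ᶜ, X ∪ compVerts 𝒞)

/-- `U(τ, X)`: the sets `𝒞` of components of `G - X` such that `τ` contains the separation
`(V \ V[𝒞], X ∪ V[𝒞])`. -/
def Tangle.bigSides {G : SimpleGraph V} (τ : G.Tangle) (X : Set V) :
    Set (Set (G.ComponentCompl X)) :=
  {𝒞 | sepTowards 𝒞 ∈ τ.seps}

/-! ### The tangle compactification -/

/-- The point set `G ⊔ Θ` of the tangle compactification of `G`. -/
def TangleCompactification (G : SimpleGraph V) : Type u :=
  G.OneComplex ⊕ G.Tangle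

namespace TangleCompactification

variable {G : SimpleGraph V}

/-- The inclusion of the 1-complex. -/
def ofPoint (p : G.OneComplex) : G.TangleCompactification := Sum.inl p

/-- The inclusion of the set of `ℵ₀`-tangles. -/
def ofTangle (τ : G.Tangle) : G.TangleCompactification := Sum.inr τ

/-- The points of the 1-complex that lie in some component `C ∈ 𝒞` (where `C` is viewed as
a 1-complex), for a set `𝒞` of components of `G - X`. -/
def compPoints {X : Set V} (𝒞 : Set (G.ComponentCompl X)) : Set G.OneComplex :=
  {p | ∃ C ∈ 𝒞, (∃ v ∈ C, p = .vertex v) ∨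
    ∃ (e : G.edgeSet) (t : Ioo (0 : ℝ) 1), (∀ v ∈ (e : Sym2 V), v ∈ C) ∧ p = .inner e t}

/-- The inner points of the edges of `G` between `X` and the union of the components in `𝒞`. -/
def crossingPoints {X : Set V} (𝒞 : Set (G.ComponentCompl X)) : Set G.OneComplex :=
  {p | ∃ (e : G.edgeSet) (t : Ioo (0 : ℝ) 1),
    (∃ x ∈ X, ∃ y ∈ compVerts 𝒞, (e : Sym2 V) = s(x, y)) ∧ p = .inner e t}

/-- The set consisting of the points of the components in `𝒞`, of all inner points of the edges
between `X` and these components, and of all tangles `τ` with `𝒞 ∈ U(τ, X)`. -/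
def basicOpen {X : Set V} (𝒞 : Set (G.ComponentCompl X)) : Set G.TangleCompactification :=
  ofPoint '' (compPoints 𝒞 ∪ crossingPoints 𝒞) ∪ ofTangle '' {τ | 𝒞 ∈ τ.bigSides X}

/-- The topology of the tangle compactification is generated by the open sets of the 1-complex
together with the sets `basicOpen 𝒞`, where `𝒞` is a set of components of `G - X` and
`X` is a finite set of vertices. -/
instance : TopologicalSpace G.TangleCompactification :=
  TopologicalSpace.generateFrom
    ({W | ∃ U : Set G.OneComplex, IsOpen U ∧ W = ofPoint '' U} ∪
      {W | ∃ X : Set V, X.Finite ∧ ∃ 𝒞 : Set (G.ComponentCompl X), W = basicOpen 𝒞})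

end TangleCompactification

/-! ### The quotient of the Stone-Čech compactification -/

/-- The 1-complex of `G`, as a subset of its Stone-Čech compactification. -/
def stoneCechImage (G : SimpleGraph V) : Set (StoneCech G.OneComplex) :=
  range stoneCechUnit

/-- The Stone-Čech remainder of the 1-complex of `G`. -/
def stoneCechRemainder (G : SimpleGraph V) : Set (StoneCech G.OneComplex) :=
  (G.stoneCechImage)ᶜ

/-- The finer topology on the Stone-Čech compactification that is obtained by declaring the
1-complex to be open: it is generated by the open sets of the Stone-Čech compactification together
with the 1-complex. -/
abbrev fineTopology (G : SimpleGraph V) : TopologicalSpace (StoneCech G.OneComplex) :=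
  TopologicalSpace.generateFrom
    ({U : Set (StoneCech G.OneComplex) | IsOpen U} ∪ {G.stoneCechImage})

/-- The equivalence relation whose classes are the connected components of the Stone-Čech remainder
(as a subspace of the Stone-Čech compactification) and the singletons in the 1-complex. -/
def remainderSetoid (G : SimpleGraph V) : Setoid (StoneCech G.OneComplex) where
  r x y := x = y ∨
    ∃ z ∈ G.stoneCechRemainder, x ∈ connectedComponentIn G.stoneCechRemainder z ∧
      y ∈ connectedComponentIn G.stoneCechRemainder z
  iseqv :=
    { refl := fun _ => Or.inl rfl
      symm := by
        rintro x y (rfl | ⟨z, hz, hx, hy⟩)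
        · exact Or.inl rfl
        · exact Or.inr ⟨z, hz, hy, hx⟩
      trans := by
        rintro x y w (rfl | ⟨z, hz, hx, hy⟩) (rfl | ⟨z', hz', hx', hy'⟩)
        · exact Or.inl rfl
        · exact Or.inr ⟨z', hz', hx', hy'⟩
        · exact Or.inr ⟨z, hz, hx, hy⟩
        · refine Or.inr ⟨z, hz, hx, ?_⟩
          rw [connectedComponentIn_eq hy, ← connectedComponentIn_eq hx']
          exact hy' }

/-- The point set of the quotient of the Stone-Čech compactification that is obtained by
collapsing every connected component of the remainder to a point. -/
def StoneCechQuotient (G : SimpleGraph V) : Type u :=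
  Quotient G.remainderSetoid

/-- The quotient topology with respect to the finer topology on the Stone-Čech compactification. -/
instance (G : SimpleGraph V) : TopologicalSpace G.StoneCechQuotient :=
  TopologicalSpace.coinduced (Quotient.mk G.remainderSetoid) G.fineTopology

/-- The canonical map from the 1-complex to the quotient. -/
def StoneCechQuotient.ofPoint {G : SimpleGraph V} (p : G.OneComplex) : G.StoneCechQuotient :=
  Quotient.mk G.remainderSetoid (stoneCechUnit p)

end SimpleGraph

end

/-!
Write `ι : G → βG` for the inclusion of the 1-complex (an embedding, since the 1-complex is completely
regular), `G*` for the remainder, and `G[A]` for the subcomplex on a set `A` of vertices.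

For a separation `(A, B)` of finite order, `G[A]` and `G[B]` are closed sets that cover `G` and meet
in the compact set `G[A ∩ B]`. Hence every point of `G*` lies in the closure of exactly one of them
(`IsSeparation.notMem_betaClosure`). Orienting every separation towards that side turns a point
`p ∈ G*` into a tangle (`remainderTangle`): a finite star of finite interior in it would cover `G` by
finitely many small sides and a compact subcomplex, none of which has `p` in its closure. As the two
closures are disjoint in `G*`, points of the same component of `G*` induce the same tangle.

Conversely, the big sides of the separations in a tangle `τ` form a filter base
(`Tangle.sup_mem`) that decides every bipartition of a big side into parts not joined by an edge
(`Tangle.compl_mem_or`). Delete from every big side short partial edges at the vertices of the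
separator. The closures of these trimmed sides form a directed family of compact sets, whose
intersection `tangleCore` is nonempty, avoids `G`, and consists of points that induce `τ`. It is
connected: a partition into two closed sets would extend to a bipartition of some trimmed side, of
which `τ` chooses one part. Given two points of `G*` that induce `τ`, the partial edges can be chosen
so short that both points lie in the core; so they lie in the same component of `G*`. Thus
`toTangleCompactification` induces a bijection from the quotient onto the tangle compactification.

It is continuous because the preimage of the basic open set given by a separation `(A, B)` is the
complement of the closure of `G[A]`. It is open because for a saturated set `W`, open in the fine
topology and meeting `G*` in points that induce `τ`, compactness gives a separation in `τ` such that
all points of `G` outside its small side lie in `W` (`exists_compl_subcomplex_subset`) and, through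
the cores, all tangles containing it come from points of `W`.
-/

noncomputable section

/-! ### Closures in the Stone-Čech remainder -/

/-- Two closed sets that cover `X` and meet in a compact set have disjoint closures in the
Stone-Čech remainder: glue a Urysohn function that vanishes on the compact intersection but not
at `p` to the zero function, and extend the result to the Stone-Čech compactification. -/
theorem notMem_closure_stoneCechUnit_image {X : Type*} [TopologicalSpace X] {F₁ F₂ : Set X}
    (h₁ : IsClosed F₁) (h₂ : IsClosed F₂) (hu : F₁ ∪ F₂ = univ) (hc : IsCompact (F₁ ∩ F₂))
    {p : StoneCech X} (hp : p ∉ range (stoneCechUnit : X → StoneCech X))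
    (hp₁ : p ∈ closure (stoneCechUnit '' F₁)) : p ∉ closure (stoneCechUnit '' F₂) := by
  classical
  intro hp₂
  obtain ⟨h, h0, h1, hI⟩ := exists_continuous_zero_one_of_isClosed
    (hc.image continuous_stoneCechUnit).isClosed (isClosed_singleton (x := p)) (by
      rw [disjoint_singleton_right]
      exact fun hmem => hp (image_subset_range _ _ hmem))
  let h' : StoneCech X → Icc (0 : ℝ) 1 := fun z => ⟨h z, hI z⟩
  have hh' : Continuous h' := h.continuous.subtype_mk _
  let g : X → Icc (0 : ℝ) 1 := fun x => if x ∈ F₁ then h' (stoneCechUnit x) else 0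
  have hg₁ : ∀ x ∈ F₁, g x = h' (stoneCechUnit x) := fun x hx => if_pos hx
  have hg₂ : ∀ x ∈ F₂, g x = 0 := by
    intro x hx
    by_cases hx' : x ∈ F₁
    · rw [hg₁ x hx']
      exact Subtype.ext (h0 ⟨x, ⟨hx', hx⟩, rfl⟩)
    · exact if_neg hx'
  have hg : Continuous g := by
    rw [← continuousOn_univ, ← hu]
    refine ContinuousOn.union_of_isClosed ?_ ?_ h₁ h₂
    · exact ((hh'.comp continuous_stoneCechUnit).continuousOn).congr hg₁
    · exact continuousOn_const.congr hg₂
  have e₁ : stoneCechExtend hg p = h' p := by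
    refine closure_minimal (t := {z | stoneCechExtend hg z = h' z}) ?_
      (isClosed_eq (continuous_stoneCechExtend hg) hh') hp₁
    rintro _ ⟨x, hx, rfl⟩
    simp only [mem_ofPred_eq, stoneCechExtend_stoneCechUnit, hg₁ x hx]
  have e₂ : stoneCechExtend hg p = 0 := by
    refine closure_minimal (t := {z | stoneCechExtend hg z = 0}) ?_
      (isClosed_eq (continuous_stoneCechExtend hg) continuous_const) hp₂
    rintro _ ⟨x, hx, rfl⟩
    simp only [mem_ofPred_eq, stoneCechExtend_stoneCechUnit, hg₂ x hx]
  have : h p = 0 := congrArg Subtype.val (e₁.symm.trans e₂)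
  have h1p : h p = 1 := h1 (mem_singleton p)
  linarith

namespace SimpleGraph

universe u

variable {V : Type u} {G : SimpleGraph V}

/-! ### Points, subcomplexes and compactness in the 1-complex -/

namespace OneComplex

/-- The endvertex of `e` at parameter `0`. -/
def tail (e : G.edgeSet) : V := (Quot.out (e : Sym2 V)).1

/-- The endvertex of `e` at parameter `1`. -/
def head (e : G.edgeSet) : V := (Quot.out (e : Sym2 V)).2

theorem mk_tail_head (e : G.edgeSet) : s(tail e, head e) = (e : Sym2 V) :=
  Quot.out_eq (e : Sym2 V)

theorem adj_tail_head (e : G.edgeSet) : G.Adj (tail e) (head e) := by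
  rw [← mem_edgeSet, mk_tail_head]
  exact e.2

theorem tail_ne_head (e : G.edgeSet) : tail e ≠ head e := (adj_tail_head e).ne

theorem mem_edge_iff {e : G.edgeSet} {v : V} : v ∈ (e : Sym2 V) ↔ v = tail e ∨ v = head e := by
  rw [← mk_tail_head, Sym2.mem_iff]

theorem edgeMap_zero (e : G.edgeSet) : edgeMap e 0 = vertex (tail e) := by
  simp [edgeMap, tail]

theorem edgeMap_one (e : G.edgeSet) : edgeMap e 1 = vertex (head e) := by
  simp [edgeMap, head]

theorem edgeMap_of_mem (e : G.edgeSet) {t : Icc (0 : ℝ) 1} (ht : (t : ℝ) ∈ Ioo (0 : ℝ) 1) :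
    edgeMap e t = inner e ⟨t, ht⟩ := by
  simp only [edgeMap, dif_pos ht]

theorem inner_eq_edgeMap (e : G.edgeSet) (t : Ioo (0 : ℝ) 1) :
    inner e t = edgeMap e ⟨t, Ioo_subset_Icc_self t.2⟩ :=
  (edgeMap_of_mem e (t := ⟨t, Ioo_subset_Icc_self t.2⟩) t.2).symm

theorem eq_zero_or_one_or_mem_Ioo (t : Icc (0 : ℝ) 1) :
    t = 0 ∨ t = 1 ∨ (t : ℝ) ∈ Ioo (0 : ℝ) 1 := by
  rcases eq_or_lt_of_le t.2.1 with h | h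
  · exact Or.inl (Subtype.ext h.symm)
  · rcases eq_or_lt_of_le t.2.2 with h' | h'
    · exact Or.inr (Or.inl (Subtype.ext h'))
    · exact Or.inr (Or.inr ⟨h, h'⟩)

theorem edgeMap_injective (e : G.edgeSet) : Function.Injective (edgeMap e) := by
  intro s t h
  have hne := tail_ne_head e
  rcases eq_zero_or_one_or_mem_Ioo s with rfl | rfl | hs <;>
    rcases eq_zero_or_one_or_mem_Ioo t with rfl | rfl | ht <;>
    simp only [edgeMap_zero, edgeMap_one, edgeMap_of_mem, *, vertex.injEq, reduceCtorEq,
      inner.injEq, Subtype.mk.injEq, hne.symm, true_and] at h ⊢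
  exact Subtype.ext h

theorem continuous_edgeMap (e : G.edgeSet) : Continuous (edgeMap e) :=
  continuous_def.2 fun U hU => (isOpen_iff U).1 hU e

theorem isClosed_iff_preimage (S : Set G.OneComplex) :
    IsClosed S ↔ ∀ e, IsClosed (edgeMap e ⁻¹' S) := by
  simp only [← isOpen_compl_iff, isOpen_iff, preimage_compl]

theorem continuous_of_comp_edgeMap {Z : Type*} [TopologicalSpace Z] {f : G.OneComplex → Z}
    (h : ∀ e, Continuous (f ∘ edgeMap e)) : Continuous f :=
  continuous_def.2 fun U hU => (isOpen_iff _).2 fun e => (h e).isOpen_preimage U hU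

/-- A set that meets every closed edge in only finitely many points is closed. -/
theorem isClosed_of_finite_preimage {S : Set G.OneComplex}
    (h : ∀ e, (edgeMap e ⁻¹' S).Finite) : IsClosed S :=
  (isClosed_iff_preimage S).2 fun e => (h e).isClosed

instance : T1Space G.OneComplex where
  t1 p := isClosed_of_finite_preimage fun e =>
    (finite_singleton p).preimage (edgeMap_injective e).injOn

/-- A continuous function separating a point `p` from a closed set `K` is found by applying
Urysohn's lemma on every edge separately, with value `1` prescribed at each endvertex
other than `p`. -/
instance : CompletelyRegularSpace G.OneComplex where
  completely_regular p K hK hp := by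
    classical
    have key : ∀ e : G.edgeSet, ∃ f : C(Icc (0 : ℝ) 1, ℝ),
        EqOn f 0 (edgeMap e ⁻¹' {p}) ∧
          EqOn f 1 (edgeMap e ⁻¹' K ∪ ({0, 1} \ edgeMap e ⁻¹' {p})) ∧
            ∀ x, f x ∈ Icc (0 : ℝ) 1 := by
      intro e
      apply exists_continuous_zero_one_of_isClosed
      · exact isClosed_singleton.preimage (continuous_edgeMap e)
      · exact (hK.preimage (continuous_edgeMap e)).union
          (((finite_singleton _).insert _).subset sdiff_subset).isClosed
      · rw [Set.disjoint_left]
        rintro t ht (h | h)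
        · exact hp (by simpa [mem_preimage, mem_singleton_iff.1 ht] using h)
        · exact h.2 ht
    choose f hf0 hf1 hf using key
    let g : G.OneComplex → Icc (0 : ℝ) 1 := fun q => match q with
      | vertex v => if vertex v = p then 0 else 1
      | inner e t => ⟨f e ⟨t, Ioo_subset_Icc_self t.2⟩, hf e _⟩
    have hg : ∀ e t, g (edgeMap e t) = ⟨f e t, hf e t⟩ := by
      intro e t
      have hend : t ∈ ({0, 1} : Set (Icc (0 : ℝ) 1)) →
          (if edgeMap e t = p then (0 : Icc (0 : ℝ) 1) else 1) = ⟨f e t, hf e t⟩ := by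
        intro ht
        apply Subtype.ext
        split_ifs with h
        · exact (hf0 e h).symm
        · exact (hf1 e (Or.inr ⟨ht, h⟩)).symm
      rcases eq_zero_or_one_or_mem_Ioo t with rfl | rfl | ht
      · rw [← hend (by simp), edgeMap_zero]
      · rw [← hend (by simp), edgeMap_one]
      · rw [edgeMap_of_mem e ht]
    refine ⟨g, continuous_of_comp_edgeMap fun e => ?_, ?_, ?_⟩
    · have : g ∘ edgeMap e = fun t => ⟨f e t, hf e t⟩ := funext (hg e)
      rw [this]
      exact (f e).continuous.subtype_mk _
    · cases p with
      | vertex v => simp [g]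
      | inner e t =>
        rw [inner_eq_edgeMap, hg]
        exact Subtype.ext (hf0 e (inner_eq_edgeMap e t).symm)
    · intro q hq
      cases q with
      | vertex v =>
        have : vertex v ≠ p := fun h => hp (h ▸ hq)
        simp [g, this]
      | inner e t =>
        rw [inner_eq_edgeMap, hg]
        rw [inner_eq_edgeMap] at hq
        exact Subtype.ext (hf1 e (Or.inl hq))

/-- The set of the vertices spanning the smallest subcomplex that contains a point: a vertex
itself, or the two ends of the edge on which an inner edge point lies. -/
def ends : G.OneComplex → Set V
  | vertex v => {v}
  | inner e _ => {w | w ∈ (e : Sym2 V)}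

@[simp] theorem ends_vertex (v : V) : (vertex v : G.OneComplex).ends = {v} := rfl

@[simp] theorem ends_inner (e : G.edgeSet) (t : Ioo (0 : ℝ) 1) :
    (inner e t).ends = {tail e, head e} :=
  Set.ext fun _ => mem_edge_iff

theorem finite_ends (p : G.OneComplex) : p.ends.Finite := by
  cases p <;> simp

variable (G) in
/-- The 1-complex of the induced subgraph `G[A]`, as a set of points of the 1-complex of `G`. -/
def subcomplex (A : Set V) : Set G.OneComplex := {p | p.ends ⊆ A}

theorem mem_subcomplex {A : Set V} {p : G.OneComplex} : p ∈ subcomplex G A ↔ p.ends ⊆ A :=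
  Iff.rfl

theorem edgeMap_mem_subcomplex {e : G.edgeSet} {A : Set V} (ht : tail e ∈ A) (hh : head e ∈ A)
    (t : Icc (0 : ℝ) 1) : edgeMap e t ∈ subcomplex G A := by
  rcases eq_zero_or_one_or_mem_Ioo t with rfl | rfl | h
  · simpa [edgeMap_zero, mem_subcomplex]
  · simpa [edgeMap_one, mem_subcomplex]
  · simp [edgeMap_of_mem e h, mem_subcomplex, insert_subset_iff, ht, hh]

theorem subcomplex_mono {A B : Set V} (h : A ⊆ B) : subcomplex G A ⊆ subcomplex G B :=
  fun _ hp => hp.trans h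

theorem subcomplex_inter (A B : Set V) :
    subcomplex G A ∩ subcomplex G B = subcomplex G (A ∩ B) :=
  Set.ext fun _ => subset_inter_iff.symm

theorem isClosed_subcomplex (A : Set V) : IsClosed (subcomplex G A) := by
  refine (isClosed_iff_preimage _).2 fun e => ?_
  by_cases h : tail e ∈ A ∧ head e ∈ A
  · rw [eq_univ_of_forall (s := edgeMap e ⁻¹' subcomplex G A)
      (edgeMap_mem_subcomplex h.1 h.2)]
    exact isClosed_univ
  · refine Set.Finite.isClosed (((finite_singleton 1).insert 0).subset fun t ht => ?_)
    rcases eq_zero_or_one_or_mem_Ioo t with rfl | rfl | ht'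
    · simp
    · simp
    · rw [mem_preimage, edgeMap_of_mem e ht', mem_subcomplex, ends_inner] at ht
      exact absurd ⟨ht (by simp), ht (by simp)⟩ h

theorem isCompact_subcomplex {A : Set V} (hA : A.Finite) : IsCompact (subcomplex G A) := by
  let E : Set G.edgeSet := {e | tail e ∈ A ∧ head e ∈ A}
  have hE : E.Finite := by
    refine Set.Finite.of_finite_image ((hA.prod hA).subset ?_ :
      ((fun e => (tail e, head e)) '' E).Finite) ?_
    · rintro _ ⟨e, he, rfl⟩
      exact he
    · intro e _ f _ h
      apply Subtype.ext
      obtain ⟨h1, h2⟩ := Prod.mk.inj h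
      rw [← mk_tail_head e, ← mk_tail_head f, h1, h2]
  have h1 : IsCompact (vertex '' A ∪ ⋃ e ∈ E, range (edgeMap e)) :=
    (hA.image _).isCompact.union (hE.isCompact_biUnion fun e _ =>
      isCompact_range (continuous_edgeMap e))
  refine h1.of_isClosed_subset (isClosed_subcomplex A) fun p hp => ?_
  cases p with
  | vertex v => exact Or.inl ⟨v, by simpa [mem_subcomplex] using hp, rfl⟩
  | inner e t =>
    rw [mem_subcomplex, ends_inner] at hp
    refine Or.inr (mem_biUnion (x := e) ⟨hp (by simp), hp (by simp)⟩ ?_)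
    exact ⟨_, (inner_eq_edgeMap e t).symm⟩

end OneComplex

open OneComplex

theorem IsSeparation.swap {s : Set V × Set V} (h : G.IsSeparation s) : G.IsSeparation s.swap := by
  obtain ⟨h1, h2, h3⟩ := h
  exact ⟨by rwa [Prod.fst_swap, Prod.snd_swap, inter_comm],
    by rwa [Prod.fst_swap, Prod.snd_swap, union_comm], fun a ha b hb hab => h3 b hb a ha hab.symm⟩

theorem IsSeparation.subset_or_subset {s : Set V × Set V} (h : G.IsSeparation s)
    (p : G.OneComplex) : p.ends ⊆ s.1 ∨ p.ends ⊆ s.2 := by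
  obtain ⟨-, h2, h3⟩ := h
  have hu : ∀ v, v ∈ s.1 ∨ v ∈ s.2 := fun v => by
    rw [← mem_union, h2]
    trivial
  cases p with
  | vertex v => simpa using hu v
  | inner e t =>
    simp only [ends_inner, insert_subset_iff, singleton_subset_iff]
    have h4 := h3 (tail e)
    have h5 := h3 (head e)
    have h6 := hu (tail e)
    have h7 := hu (head e)
    have h8 := adj_tail_head e
    have h9 := h8.symm
    simp only [mem_sdiff] at h4 h5
    by_contra hcon
    grind

theorem IsSeparation.subcomplex_union {s : Set V × Set V} (h : G.IsSeparation s) :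
    subcomplex G s.1 ∪ subcomplex G s.2 = univ :=
  eq_univ_of_forall h.subset_or_subset

/-! ### Closures of subcomplexes in the Stone-Čech compactification -/

/-- The closure in the Stone-Čech compactification of a set of points of the 1-complex. -/
abbrev betaClosure (S : Set G.OneComplex) : Set (StoneCech G.OneComplex) :=
  closure (stoneCechUnit '' S)

theorem isEmbedding_stoneCechUnit :
    Topology.IsEmbedding (stoneCechUnit : G.OneComplex → StoneCech G.OneComplex) :=
  have : T35Space G.OneComplex := {}
  _root_.isEmbedding_stoneCechUnit

theorem stoneCechUnit_mem_betaClosure_iff {S : Set G.OneComplex} (hS : IsClosed S)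
    {p : G.OneComplex} : stoneCechUnit p ∈ betaClosure S ↔ p ∈ S := by
  rw [← mem_preimage, ← isEmbedding_stoneCechUnit.closure_eq_preimage_closure_image,
    hS.closure_eq]

theorem betaClosure_mono {S T : Set G.OneComplex} (h : S ⊆ T) : betaClosure S ⊆ betaClosure T :=
  closure_mono (image_mono h)

theorem betaClosure_union (S T : Set G.OneComplex) :
    betaClosure (S ∪ T) = betaClosure S ∪ betaClosure T := by
  rw [betaClosure, image_union, closure_union]

theorem mem_betaClosure_of_univ_subset {S : Set G.OneComplex} (h : univ ⊆ S)
    (p : StoneCech G.OneComplex) : p ∈ betaClosure S := by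
  have h' : S = univ := univ_subset_iff.1 h
  rw [betaClosure, h', image_univ, denseRange_stoneCechUnit.closure_range]
  trivial

theorem stoneCechUnit_notMem_remainder (p : G.OneComplex) :
    stoneCechUnit p ∉ G.stoneCechRemainder :=
  fun h => h (mem_range_self p)

theorem notMem_betaClosure_of_finite {A : Set V} (hA : A.Finite)
    {p : StoneCech G.OneComplex} (hp : p ∈ G.stoneCechRemainder) :
    p ∉ betaClosure (subcomplex G A) := by
  rw [betaClosure,
    ((isCompact_subcomplex hA).image continuous_stoneCechUnit).isClosed.closure_eq]
  exact fun h => hp (image_subset_range _ _ h)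

theorem IsSeparation.notMem_betaClosure {s : Set V × Set V} (hs : G.IsSeparation s)
    {p : StoneCech G.OneComplex} (hp : p ∈ G.stoneCechRemainder)
    (h : p ∈ betaClosure (subcomplex G s.2)) : p ∉ betaClosure (subcomplex G s.1) := by
  intro h'
  refine notMem_closure_stoneCechUnit_image (isClosed_subcomplex _) (isClosed_subcomplex _)
    hs.subcomplex_union ?_ hp h' h
  rw [subcomplex_inter]
  exact isCompact_subcomplex hs.1

theorem IsSeparation.mem_betaClosure_or {s : Set V × Set V} (hs : G.IsSeparation s)
    (p : StoneCech G.OneComplex) :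
    p ∈ betaClosure (subcomplex G s.1) ∨ p ∈ betaClosure (subcomplex G s.2) := by
  rw [← mem_union, ← betaClosure_union]
  exact mem_betaClosure_of_univ_subset hs.subcomplex_union.ge p

/-! ### The tangle induced by a point of the remainder -/

/-- The `ℵ₀`-tangle induced by a point `p` of the Stone-Čech remainder: it orients every
separation towards the side whose 1-complex has `p` in its closure. -/
def remainderTangle (p : StoneCech G.OneComplex) (hp : p ∈ G.stoneCechRemainder) : G.Tangle where
  seps := {s | G.IsSeparation s ∧ p ∈ betaClosure (subcomplex G s.2)}
  isOrientation := by
    refine ⟨fun s hs => hs.1, fun s hs => ⟨?_, fun h h' => ?_⟩⟩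
    · exact (hs.mem_betaClosure_or p).symm.imp (fun h => ⟨hs, h⟩) fun h => ⟨hs.swap, h⟩
    · exact absurd h'.2 (hs.notMem_betaClosure hp h.2)
  isConsistent := by
    rintro r hr s hs - ⟨⟨-, hle⟩, -⟩
    exact hr.1.notMem_betaClosure hp hr.2 (betaClosure_mono (subcomplex_mono hle) hs.2)
  not_finite_star := by
    intro σ hσ hfin _ hinf
    -- The small sides of `σ` together with its interior cover the 1-complex.
    have hcov : (univ : Set G.OneComplex) ⊆
        (⋃ s ∈ σ, subcomplex G s.1) ∪ subcomplex G (starInterior σ) := by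
      intro q _
      by_cases h : ∃ s ∈ σ, q.ends ⊆ s.1
      · obtain ⟨s, hs, hq⟩ := h
        exact Or.inl (mem_biUnion hs hq)
      · push Not at h
        exact Or.inr (subset_iInter₂ fun s hs =>
          ((hσ hs).1.subset_or_subset q).resolve_left (h s hs))
    have hmem := mem_betaClosure_of_univ_subset hcov p
    rw [betaClosure_union] at hmem
    rcases hmem with h | h
    · rw [betaClosure, image_iUnion₂, hfin.closure_biUnion] at h
      obtain ⟨s, hs, hps⟩ := mem_iUnion₂.1 h
      exact (hσ hs).1.notMem_betaClosure hp (hσ hs).2 hps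
    · exact notMem_betaClosure_of_finite hinf hp h

theorem mem_remainderTangle_iff_notMem {p : StoneCech G.OneComplex}
    {hp : p ∈ G.stoneCechRemainder} {s : Set V × Set V} (hs : G.IsSeparation s) :
    s ∈ (remainderTangle p hp).seps ↔ p ∉ betaClosure (subcomplex G s.1) :=
  ⟨fun h => hs.notMem_betaClosure hp h.2,
    fun h => ⟨hs, (hs.mem_betaClosure_or p).resolve_left h⟩⟩

/-- The trace on the remainder of the closure of either side of a separation is clopen, so that
points in a common connected component induce the same tangle. -/
theorem remainderTangle_eq_of_mem_connectedComponentIn {p q z : StoneCech G.OneComplex}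
    (hp : p ∈ G.stoneCechRemainder) (hq : q ∈ G.stoneCechRemainder)
    (hpz : p ∈ connectedComponentIn G.stoneCechRemainder z)
    (hqz : q ∈ connectedComponentIn G.stoneCechRemainder z) :
    remainderTangle p hp = remainderTangle q hq := by
  have key : ∀ {p q : StoneCech G.OneComplex} (hp : p ∈ G.stoneCechRemainder)
      (hq : q ∈ G.stoneCechRemainder)
      (_ : p ∈ connectedComponentIn G.stoneCechRemainder z)
      (_ : q ∈ connectedComponentIn G.stoneCechRemainder z),
      (remainderTangle p hp).seps ⊆ (remainderTangle q hq).seps := by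
    intro p q hp hq hpz hqz s hs
    refine ⟨hs.1, ?_⟩
    by_contra hqs
    obtain ⟨r, hr, hr1, hr2⟩ := isPreconnected_closed_iff.1 isPreconnected_connectedComponentIn
      _ _ (isClosed_closure (s := stoneCechUnit '' subcomplex G s.1))
      (isClosed_closure (s := stoneCechUnit '' subcomplex G s.2))
      (fun x _ => hs.1.mem_betaClosure_or x)
      ⟨q, hqz, (hs.1.mem_betaClosure_or q).resolve_right hqs⟩ ⟨p, hpz, hs.2⟩
    exact hs.1.notMem_betaClosure (connectedComponentIn_subset _ _ hr) hr2 hr1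
  exact Tangle.ext ((key hp hq hpz hqz).antisymm (key hq hp hqz hpz))

/-! ### Tangles are closed under intersecting big sides -/

namespace Tangle

variable (τ : G.Tangle)

theorem isSeparation {s : Set V × Set V} (hs : s ∈ τ.seps) : G.IsSeparation s :=
  τ.isOrientation.1 s hs

theorem mem_or_swap_mem {s : Set V × Set V} (hs : G.IsSeparation s) :
    s ∈ τ.seps ∨ s.swap ∈ τ.seps :=
  (τ.isOrientation.2 s hs).1

theorem eq_of_subset {σ τ : G.Tangle} (h : τ.seps ⊆ σ.seps) : τ = σ := by
  refine Tangle.ext (h.antisymm fun s hs => ?_)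
  rcases τ.mem_or_swap_mem (σ.isSeparation hs) with h' | h'
  · exact h'
  · rw [(σ.isOrientation.2 s (σ.isSeparation hs)).2 hs (h h')]
    exact h'

theorem infinite_snd {s : Set V × Set V} (hs : s ∈ τ.seps) : s.2.Infinite := by
  intro hfin
  refine τ.not_finite_star {s} (by simpa) (finite_singleton s) ?_ (by simpa [starInterior])
  rintro r rfl t rfl h
  exact absurd rfl h

theorem exists_notMem_fst {s : Set V × Set V} (hs : s ∈ τ.seps) : ∃ v, v ∉ s.1 := by
  by_contra! h
  exact τ.infinite_snd hs ((τ.isSeparation hs).1.subset fun v hv => ⟨h v, hv⟩)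

theorem infinite_starInterior_triple {r s t : Set V × Set V} (hr : r ∈ τ.seps)
    (hs : s ∈ τ.seps) (ht : t ∈ τ.seps) (hrs : SepLE r s.swap) (hrt : SepLE r t.swap)
    (hst : SepLE s t.swap) : (r.2 ∩ s.2 ∩ t.2).Infinite := by
  intro hfin
  refine τ.not_finite_star {r, s, t} ?_ (by simp) ?_ (hfin.subset ?_)
  · rintro _ (rfl | rfl | rfl) <;> assumption
  · have hsymm : ∀ {a b : Set V × Set V}, SepLE a b.swap → SepLE b a.swap :=
      fun h => ⟨h.2, h.1⟩
    rintro _ (rfl | rfl | rfl) _ (rfl | rfl | rfl) hne <;>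
      first
      | exact absurd rfl hne
      | assumption
      | exact hsymm ‹_›
  · intro v hv
    simp only [starInterior, mem_iInter] at hv
    exact ⟨⟨hv r (by simp), hv s (by simp)⟩, hv t (by simp)⟩

/-- Tangles are closed downwards in the order of separations. -/
theorem mem_of_le {s t : Set V × Set V} (hs : G.IsSeparation s) (ht : t ∈ τ.seps)
    (h : SepLE s t) : s ∈ τ.seps := by
  refine (τ.mem_or_swap_mem hs).resolve_right fun hs' => ?_
  by_cases h1 : s = t
  · subst h1
    have h2 := (τ.isOrientation.2 s hs).2 ht hs'
    have h3 : s.1 = s.2 := congrArg Prod.fst h2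
    have h4 := hs.1
    rw [h3, inter_self] at h4
    exact τ.infinite_snd ht h4
  by_cases h2 : s.swap = t
  · -- In this degenerate case `s.1 ⊆ s.2`, so the big side `s.1` of `s.swap` is finite.
    subst h2
    exact τ.infinite_snd hs' (hs.1.subset fun v hv => ⟨hv, h.1 hv⟩)
  · exact τ.isConsistent s.swap hs' t ht h2 ⟨by simpa using h, by simpa using h1⟩

theorem finite_univ_mem {X : Set V} (hX : X.Finite) : (X, univ) ∈ τ.seps := by
  have hs : G.IsSeparation (X, univ) :=
    ⟨hX.subset inter_subset_left, union_univ _, fun a ha => absurd (mem_univ a) ha.2⟩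
  exact (τ.mem_or_swap_mem hs).resolve_right fun h => τ.infinite_snd h hX

theorem sup_mem {s t : Set V × Set V} (hs : s ∈ τ.seps) (ht : t ∈ τ.seps) :
    (s.1 ∪ t.1, s.2 ∩ t.2) ∈ τ.seps := by
  obtain ⟨s1, s2, s3⟩ := τ.isSeparation hs
  obtain ⟨t1, t2, t3⟩ := τ.isSeparation ht
  have hsu : ∀ v, v ∈ s.1 ∨ v ∈ s.2 := fun v => by rw [← mem_union, s2]; trivial
  have htu : ∀ v, v ∈ t.1 ∨ v ∈ t.2 := fun v => by rw [← mem_union, t2]; trivial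
  have hsup : G.IsSeparation (s.1 ∪ t.1, s.2 ∩ t.2) := by
    refine ⟨(s1.union t1).subset ?_, ?_, ?_⟩
    · rintro v ⟨h | h, h'⟩
      · exact Or.inl ⟨h, h'.1⟩
      · exact Or.inr ⟨h, h'.2⟩
    · refine eq_univ_of_forall fun v => ?_
      have := hsu v
      have := htu v
      simp only [mem_union, mem_inter_iff]
      tauto
    · rintro a ⟨ha, ha'⟩ b ⟨hb, hb'⟩
      have h1 := s3 a
      have h2 := t3 a
      simp only [mem_union, mem_inter_iff, mem_sdiff] at ha ha' hb hb' h1 h2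
      by_cases has : a ∈ s.2
      · exact h2 ⟨by grind, by grind⟩ b ⟨hb.2, by grind⟩
      · exact h1 ⟨by grind, has⟩ b ⟨hb.1, by grind⟩
  -- Replace `t` by a smaller separation so that it forms a star with `s` and the swapped supremum.
  have htle : (t.1 ∩ s.2, t.2 ∪ s.1) ∈ τ.seps := by
    refine τ.mem_of_le ⟨(s1.union t1).subset ?_, ?_, ?_⟩ ht
      ⟨inter_subset_left, subset_union_left⟩
    · rintro v ⟨h, h' | h'⟩
      · exact Or.inr ⟨h.1, h'⟩
      · exact Or.inl ⟨h', h.2⟩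
    · refine eq_univ_of_forall fun v => ?_
      have := hsu v
      have := htu v
      simp only [mem_union, mem_inter_iff]
      tauto
    · rintro a ⟨ha, ha'⟩ b ⟨hb, hb'⟩ hab
      have h1 := s3 b
      have h2 := t3 a
      simp only [mem_union, mem_inter_iff, mem_sdiff] at ha ha' hb hb' h1 h2
      by_cases hbt : b ∈ t.1
      · exact h1 ⟨by grind, by grind⟩ a ⟨ha.2, by grind⟩ hab.symm
      · exact h2 ⟨ha.1, by grind⟩ b ⟨by grind, hbt⟩ hab
  refine (τ.mem_or_swap_mem hsup).resolve_right fun hsw => ?_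
  refine τ.infinite_starInterior_triple hs htle hsw ⟨subset_union_right, inter_subset_right⟩
    ⟨subset_union_left, inter_subset_left⟩ ⟨fun v hv => Or.inr hv.1, fun v hv => Or.inl hv.2⟩
    ((s1.union t1).subset ?_)
  rintro v ⟨⟨h1, h2⟩, h3⟩
  simp only [Prod.snd_swap, mem_union, mem_inter_iff] at h1 h2 h3 ⊢
  tauto

/-- A tangle containing `s` decides every bipartition of the vertices outside the small side of
`s` into sets that are not joined by an edge. -/
theorem compl_mem_or {s : Set V × Set V} (hs : s ∈ τ.seps) {D₁ D₂ : Set V}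
    (hD : D₁ ∪ D₂ = s.1ᶜ) (hdisj : Disjoint D₁ D₂)
    (hadj : ∀ a ∈ D₁, ∀ b ∈ D₂, ¬ G.Adj a b) :
    (D₁ᶜ, s.1 ∩ s.2 ∪ D₁) ∈ τ.seps ∨ (D₂ᶜ, s.1 ∩ s.2 ∪ D₂) ∈ τ.seps := by
  obtain ⟨s1, s2, s3⟩ := τ.isSeparation hs
  have hsu : ∀ v, v ∈ s.1 ∨ v ∈ s.2 := fun v => by rw [← mem_union, s2]; trivial
  have hDv : ∀ v, v ∈ D₁ ∨ v ∈ D₂ ↔ v ∉ s.1 := fun v => by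
    rw [← mem_union, hD]
    rfl
  rw [Set.disjoint_left] at hdisj
  have hsep : ∀ {E₁ E₂ : Set V}, (∀ v, v ∈ E₁ ∨ v ∈ E₂ ↔ v ∉ s.1) →
      (∀ a ∈ E₁, ∀ b ∈ E₂, ¬ G.Adj a b) → G.IsSeparation (E₁ᶜ, s.1 ∩ s.2 ∪ E₁) := by
    intro E₁ E₂ hE hEadj
    refine ⟨s1.subset ?_, ?_, ?_⟩
    · rintro v ⟨h, h' | h'⟩
      · exact h'
      · exact absurd h' h
    · refine eq_univ_of_forall fun v => ?_
      by_cases h : v ∈ E₁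
      · exact Or.inr (Or.inr h)
      · exact Or.inl h
    · rintro a ⟨ha, ha'⟩ b ⟨hb, hb'⟩ hab
      have h1 := s3 a
      have h2 := hEadj b (not_not.1 hb') a
      have h3 := hE a
      have h4 := hE b
      have h5 := hsu b
      have h6 := G.adj_comm a b
      simp only [mem_compl_iff, mem_union, mem_inter_iff, mem_sdiff, not_not] at *
      grind
  have h1 := hsep hDv hadj
  have h2 := hsep (E₁ := D₂) (E₂ := D₁) (fun v => by rw [or_comm, hDv])
    fun a ha b hb hab => hadj b hb a ha hab.symm
  by_contra! hcon
  have h1' := (τ.mem_or_swap_mem h1).resolve_left hcon.1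
  have h2' := (τ.mem_or_swap_mem h2).resolve_left hcon.2
  have hs' : (s.1, s.1 ∩ s.2 ∪ s.1ᶜ) ∈ τ.seps := by
    have hsep' := hsep (E₁ := s.1ᶜ) (E₂ := ∅) (by simp) (by simp)
    rw [compl_compl] at hsep'
    refine τ.mem_of_le hsep' hs ⟨le_rfl, ?_⟩
    · intro v hv
      by_cases h : v ∈ s.1
      · exact Or.inl ⟨h, hv⟩
      · exact Or.inr h
  refine τ.infinite_starInterior_triple h1' h2' hs' ⟨?_, ?_⟩ ⟨?_, ?_⟩ ⟨?_, ?_⟩ (s1.subset ?_) <;>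
    intro v <;> have := hDv v <;> have := @hdisj v <;>
    simp only [Prod.fst_swap, Prod.snd_swap, mem_compl_iff, mem_union, mem_inter_iff] <;> grind

end Tangle

/-- Compactness along a tangle: the small sides of its separations are directed, by
`Tangle.sup_mem`. -/
theorem exists_subset_of_iInter_subset (τ : G.Tangle) {F : Set V → Set (StoneCech G.OneComplex)}
    (hF : Antitone F) (hcl : ∀ A, IsClosed (F A)) {W : Set (StoneCech G.OneComplex)}
    (hW : IsOpen W) (h : ∀ x, (∀ s ∈ τ.seps, x ∈ F s.1) → x ∈ W) :
    ∃ s ∈ τ.seps, F s.1 ⊆ W := by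
  have : Nonempty τ.seps := ⟨⟨_, τ.finite_univ_mem finite_empty⟩⟩
  obtain ⟨⟨s, hs⟩, hsW⟩ := exists_subset_nhds_of_compactSpace
    (V := fun s : τ.seps => F s.1.1)
    (fun s t => ⟨⟨_, τ.sup_mem s.2 t.2⟩, hF subset_union_left, hF subset_union_right⟩)
    (fun s => hcl _) (U := W) fun x hx =>
      hW.mem_nhds (h x fun s hs => mem_iInter.1 hx ⟨s, hs⟩)
  exact ⟨s, hs, hsW⟩

/-! ### Trimmed complements of subcomplexes -/

namespace OneComplex

/-- The complement of the subcomplex on `A`, with a half-open segment of length `ε e` cut off at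
its end in `A` from every edge `e` that joins `A` to the complement of `A`. -/
def trimmed (ε : G.edgeSet → ℝ) (A : Set V) : Set G.OneComplex :=
  {p | match p with
    | vertex v => v ∉ A
    | inner e t =>
      ¬ (tail e ∈ A ∧ head e ∈ A) ∧ (tail e ∈ A → ε e ≤ t) ∧ (head e ∈ A → (t : ℝ) ≤ 1 - ε e)}

theorem vertex_mem_trimmed {ε : G.edgeSet → ℝ} {A : Set V} {v : V} :
    vertex v ∈ trimmed ε A ↔ v ∉ A :=
  Iff.rfl

theorem inner_mem_trimmed {ε : G.edgeSet → ℝ} {A : Set V} {e : G.edgeSet} {t : Ioo (0 : ℝ) 1} :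
    inner e t ∈ trimmed ε A ↔ ¬ (tail e ∈ A ∧ head e ∈ A) ∧ (tail e ∈ A → ε e ≤ t) ∧
      (head e ∈ A → (t : ℝ) ≤ 1 - ε e) :=
  Iff.rfl

theorem edgeMap_mem_trimmed {ε : G.edgeSet → ℝ} (hε : ∀ e, ε e ∈ Ioc (0 : ℝ) 1) {A : Set V}
    {e : G.edgeSet} {t : Icc (0 : ℝ) 1} :
    edgeMap e t ∈ trimmed ε A ↔ ¬ (tail e ∈ A ∧ head e ∈ A) ∧ (tail e ∈ A → ε e ≤ t) ∧
      (head e ∈ A → (t : ℝ) ≤ 1 - ε e) := by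
  obtain ⟨h0, h1⟩ := hε e
  rcases eq_zero_or_one_or_mem_Ioo t with rfl | rfl | ht
  · rw [edgeMap_zero, vertex_mem_trimmed]
    simp only [Icc.coe_zero]
    grind
  · rw [edgeMap_one, vertex_mem_trimmed]
    simp only [Icc.coe_one]
    grind
  · rw [edgeMap_of_mem e ht, inner_mem_trimmed]

theorem trimmed_antitone (ε : G.edgeSet → ℝ) : Antitone (trimmed ε) := by
  rintro A A' h (v | ⟨e, t⟩) hp
  · exact fun hv => hp (h hv)
  · exact ⟨fun hA => hp.1 ⟨h hA.1, h hA.2⟩, fun hA => hp.2.1 (h hA), fun hA => hp.2.2 (h hA)⟩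

theorem not_ends_subset_of_mem_trimmed {ε : G.edgeSet → ℝ} {A : Set V} {p : G.OneComplex}
    (hp : p ∈ trimmed ε A) : ¬ p.ends ⊆ A := by
  cases p with
  | vertex v => simpa using vertex_mem_trimmed.1 hp
  | inner e t => exact fun h => hp.1 (by simpa [insert_subset_iff] using h)

theorem ordConnected_preimage_trimmed {ε : G.edgeSet → ℝ} (hε : ∀ e, ε e ∈ Ioc (0 : ℝ) 1)
    (A : Set V) (e : G.edgeSet) : (edgeMap e ⁻¹' trimmed ε A).OrdConnected where
  out' := by
    intro r hr s hs t ht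
    rw [mem_preimage, edgeMap_mem_trimmed hε] at hr hs ⊢
    exact ⟨hr.1, fun h => (hr.2.1 h).trans ht.1, fun h => le_trans ht.2 (hs.2.2 h)⟩

theorem isClosed_trimmed {ε : G.edgeSet → ℝ} (hε : ∀ e, ε e ∈ Ioc (0 : ℝ) 1) (A : Set V) :
    IsClosed (trimmed ε A) := by
  refine (isClosed_iff_preimage _).2 fun e => ?_
  have : edgeMap e ⁻¹' trimmed ε A =
      {t : Icc (0 : ℝ) 1 | ¬ (tail e ∈ A ∧ head e ∈ A) ∧
        (tail e ∈ A → ε e ≤ t) ∧ (head e ∈ A → (t : ℝ) ≤ 1 - ε e)} :=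
    Set.ext fun t => edgeMap_mem_trimmed hε
  rw [this]
  exact isClosed_const.and ((isClosed_imp isOpen_const
    (isClosed_le continuous_const continuous_subtype_val)).and (isClosed_imp isOpen_const
      (isClosed_le continuous_subtype_val continuous_const)))

variable (G) in
/-- The open partial edges of lengths `ε e` at the vertex `v`, without `v` itself. -/
def nearVertex (ε : G.edgeSet → ℝ) (v : V) : Set G.OneComplex :=
  {p | ∃ (e : G.edgeSet) (t : Ioo (0 : ℝ) 1), p = inner e t ∧
    ((v = tail e ∧ (t : ℝ) < ε e) ∨ (v = head e ∧ 1 - ε e < t))}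

end OneComplex

/-- Since the 1-complex has arbitrarily small independent partial edges at its vertices, finitely
many points of the remainder can be kept away from suitable partial edges at all vertices. -/
theorem exists_notMem_betaClosure_nearVertex {P : Set (StoneCech G.OneComplex)} (hP : P.Finite)
    (hPr : P ⊆ G.stoneCechRemainder) :
    ∃ ε : G.edgeSet → ℝ, (∀ e, ε e ∈ Ioc (0 : ℝ) 1) ∧
      ∀ p ∈ P, ∀ v, p ∉ betaClosure (nearVertex G ε v) := by
  have h1 : ∀ v : V, ∃ W U : Set (StoneCech G.OneComplex), IsOpen W ∧ IsOpen U ∧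
      stoneCechUnit (vertex v) ∈ W ∧ P ⊆ U ∧ Disjoint W U := by
    intro v
    obtain ⟨W, U, hW, hU, hvW, hPU, hd⟩ := normal_separation
      (isClosed_singleton (x := (stoneCechUnit (vertex v) : StoneCech G.OneComplex)))
      hP.isClosed (disjoint_singleton_left.2 fun h => stoneCechUnit_notMem_remainder _ (hPr h))
    exact ⟨W, U, hW, hU, hvW rfl, hPU, hd⟩
  choose W U hW hU hvW hPU hd using h1
  have h2 : ∀ (e : G.edgeSet) (s : Icc (0 : ℝ) 1) (v : V), edgeMap e s = vertex v →
      ∃ δ > 0, ∀ t : Icc (0 : ℝ) 1, Dist.dist t s < δ → stoneCechUnit (edgeMap e t) ∈ W v := by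
    intro e s v hs
    have hopen : IsOpen (edgeMap e ⁻¹' (stoneCechUnit ⁻¹' W v)) :=
      ((hW v).preimage continuous_stoneCechUnit).preimage (continuous_edgeMap e)
    exact Metric.isOpen_iff.1 hopen s (by simpa [hs] using hvW v)
  choose δ₀ hδ₀ hδ₀' using fun e => h2 e 0 (tail e) (edgeMap_zero e)
  choose δ₁ hδ₁ hδ₁' using fun e => h2 e 1 (head e) (edgeMap_one e)
  refine ⟨fun e => min 1 (min (δ₀ e) (δ₁ e)), fun e =>
    ⟨lt_min one_pos (lt_min (hδ₀ e) (hδ₁ e)), min_le_left _ _⟩, fun p hp v hpv => ?_⟩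
  have hsub : stoneCechUnit '' nearVertex G (fun e => min 1 (min (δ₀ e) (δ₁ e))) v ⊆ (U v)ᶜ := by
    refine Subset.trans ?_ (hd v).subset_compl_right
    rintro _ ⟨_, ⟨e, t, rfl, h⟩, rfl⟩
    rw [inner_eq_edgeMap]
    rcases h with ⟨rfl, h⟩ | ⟨rfl, h⟩
    · apply hδ₀' e
      rw [Subtype.dist_eq, Real.dist_eq, Icc.coe_zero, sub_zero, abs_of_pos t.2.1]
      exact h.trans_le ((min_le_right _ _).trans (min_le_left _ _))
    · apply hδ₁' e
      rw [Subtype.dist_eq, Real.dist_eq, Icc.coe_one, abs_sub_comm,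
        abs_of_pos (sub_pos.2 t.2.2)]
      have := (min_le_right 1 (min (δ₀ e) (δ₁ e))).trans (min_le_right _ _)
      linarith
  exact closure_minimal hsub (hU v).isClosed_compl hpv (hPU v hp)

/-! ### The fibres of the map from the remainder to the tangles -/

/-- The intersection of the closures of the trimmed big sides of the separations in `τ`. For
lengths in `(0, 1]` it is a continuum, unlike the set of all points of the remainder that induce
`τ`, which need not be compact. -/
def tangleCore (ε : G.edgeSet → ℝ) (τ : G.Tangle) : Set (StoneCech G.OneComplex) :=
  ⋂ s ∈ τ.seps, betaClosure (trimmed ε s.1)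

section tangleCore

variable {ε : G.edgeSet → ℝ} {τ : G.Tangle}

theorem mem_tangleCore {p : StoneCech G.OneComplex} :
    p ∈ tangleCore ε τ ↔ ∀ s ∈ τ.seps, p ∈ betaClosure (trimmed ε s.1) :=
  mem_iInter₂

theorem isClosed_tangleCore : IsClosed (tangleCore ε τ) :=
  isClosed_biInter fun _ _ => isClosed_closure

theorem exists_betaClosure_trimmed_subset {W : Set (StoneCech G.OneComplex)} (hW : IsOpen W)
    (h : tangleCore ε τ ⊆ W) : ∃ s ∈ τ.seps, betaClosure (trimmed ε s.1) ⊆ W :=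
  exists_subset_of_iInter_subset τ (fun _ _ hA => betaClosure_mono (trimmed_antitone ε hA))
    (fun _ => isClosed_closure) hW fun _ hx => h (mem_tangleCore.2 hx)

theorem tangleCore_nonempty : (tangleCore ε τ).Nonempty := by
  by_contra h
  obtain ⟨s, hs, hsub⟩ := exists_betaClosure_trimmed_subset isOpen_empty
    (not_nonempty_iff_eq_empty.1 h).subset
  obtain ⟨v, hv⟩ := τ.exists_notMem_fst hs
  exact hsub (subset_closure (mem_image_of_mem _ (vertex_mem_trimmed.2 hv)))

theorem tangleCore_subset_remainder (hε : ∀ e, ε e ∈ Ioc (0 : ℝ) 1) :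
    tangleCore ε τ ⊆ G.stoneCechRemainder := by
  rintro _ hp ⟨q, rfl⟩
  have h := mem_tangleCore.1 hp _ (τ.finite_univ_mem q.finite_ends)
  rw [stoneCechUnit_mem_betaClosure_iff (isClosed_trimmed hε _)] at h
  exact not_ends_subset_of_mem_trimmed h Subset.rfl

theorem eq_remainderTangle {p : StoneCech G.OneComplex} (hp : p ∈ G.stoneCechRemainder)
    (h : ∀ s ∈ τ.seps, p ∈ betaClosure (subcomplex G s.2)) : τ = remainderTangle p hp :=
  Tangle.eq_of_subset fun s hs => ⟨τ.isSeparation hs, h s hs⟩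

theorem eq_remainderTangle_of_mem_tangleCore {p : StoneCech G.OneComplex}
    (hp : p ∈ G.stoneCechRemainder) (h : p ∈ tangleCore ε τ) : τ = remainderTangle p hp :=
  eq_remainderTangle hp fun s hs => betaClosure_mono (fun q hq =>
    ((τ.isSeparation hs).subset_or_subset q).resolve_left (not_ends_subset_of_mem_trimmed hq))
      (mem_tangleCore.1 h s hs)

theorem mem_tangleCore_remainderTangle {p : StoneCech G.OneComplex}
    (hp : p ∈ G.stoneCechRemainder) (h : ∀ v, p ∉ betaClosure (nearVertex G ε v)) :
    p ∈ tangleCore ε (remainderTangle p hp) := by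
  refine mem_tangleCore.2 fun s hs => ?_
  have hsep := hs.1
  -- Whatever is trimmed off outside the small side lies near a vertex of the finite separator.
  have hcov : (univ : Set G.OneComplex) ⊆
      (trimmed ε s.1 ∪ subcomplex G s.1) ∪ ⋃ v ∈ s.1 ∩ s.2, nearVertex G ε v := by
    intro q _
    by_contra hq
    simp only [mem_union, not_or] at hq
    obtain ⟨⟨h1, h2⟩, h3⟩ := hq
    cases q with
    | vertex v => exact h1 fun hv => h2 (by simpa [mem_subcomplex] using hv)
    | inner e t =>
      have h4 := (hsep.subset_or_subset (inner e t)).resolve_left h2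
      rw [mem_subcomplex, ends_inner, insert_subset_iff, singleton_subset_iff] at h2
      rw [ends_inner, insert_subset_iff, singleton_subset_iff] at h4
      refine h1 ⟨h2, fun hA => ?_, fun hA => ?_⟩
      · by_contra! hlt
        exact h3 (mem_biUnion (x := tail e) ⟨hA, h4.1⟩ ⟨e, t, rfl, Or.inl ⟨rfl, hlt⟩⟩)
      · by_contra! hlt
        exact h3 (mem_biUnion (x := head e) ⟨hA, h4.2⟩ ⟨e, t, rfl, Or.inr ⟨rfl, hlt⟩⟩)
  have hmem := mem_betaClosure_of_univ_subset hcov p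
  rw [betaClosure_union, betaClosure_union] at hmem
  rcases hmem with (h1 | h1) | h1
  · exact h1
  · exact absurd h1 (hsep.notMem_betaClosure hp hs.2)
  · rw [betaClosure, image_iUnion₂, hsep.1.closure_biUnion] at h1
    obtain ⟨v, -, hv⟩ := mem_iUnion₂.1 h1
    exact absurd hv (h v)

/-- Trimmed edges are connected, so they cannot meet both parts of a separation of the space. -/
theorem stoneCechUnit_edgeMap_mem {A : Set V} (hε : ∀ e, ε e ∈ Ioc (0 : ℝ) 1)
    {W₁ W₂ : Set (StoneCech G.OneComplex)} (hW₁ : IsOpen W₁) (hW₂ : IsOpen W₂)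
    (hd : Disjoint W₁ W₂) (hA : ∀ q ∈ trimmed ε A, stoneCechUnit q ∈ W₁ ∪ W₂)
    {e : G.edgeSet} {s t : Icc (0 : ℝ) 1} (hs : edgeMap e s ∈ trimmed ε A)
    (ht : edgeMap e t ∈ trimmed ε A) (h : stoneCechUnit (edgeMap e s) ∈ W₁) :
    stoneCechUnit (edgeMap e t) ∈ W₁ := by
  have hpre : IsPreconnected (edgeMap e ⁻¹' trimmed ε A) := by
    have := ordConnected_preimage_trimmed hε A e
    rw [← Topology.IsInducing.subtypeVal.isPreconnected_image]
    refine Set.OrdConnected.isPreconnected ⟨?_⟩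
    rintro _ ⟨x, hx, rfl⟩ _ ⟨y, hy, rfl⟩ z hz
    exact ⟨⟨z, x.2.1.trans hz.1, hz.2.trans y.2.2⟩, Set.OrdConnected.out this hx hy hz, rfl⟩
  have hcont : Continuous fun t => (stoneCechUnit (edgeMap e t) : StoneCech G.OneComplex) :=
    continuous_stoneCechUnit.comp (continuous_edgeMap e)
  refine IsPreconnected.subset_left_of_subset_union hW₁ hW₂ hd ?_ ?_
    (hpre.image _ hcont.continuousOn) ⟨t, ht, rfl⟩
  · rintro _ ⟨x, hx, rfl⟩
    exact hA _ hx
  · exact ⟨_, ⟨s, hs, rfl⟩, h⟩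

/-- If disjoint open sets cover the core, then by compactness they cover some trimmed big side of
`τ`. Since edges are connected they induce a bipartition of its vertices without cross edges, one
side of which belongs to `τ`. -/
theorem isPreconnected_tangleCore (hε : ∀ e, ε e ∈ Ioc (0 : ℝ) 1) :
    IsPreconnected (tangleCore ε τ) := by
  rw [isPreconnected_iff_subset_of_fully_disjoint_closed isClosed_tangleCore]
  intro F₁ F₂ hF₁ hF₂ hsub hdisj
  obtain ⟨W₁, W₂, hW₁, hW₂, hFW₁, hFW₂, hd⟩ :=
    normal_separation hF₁ hF₂ hdisj
  obtain ⟨s, hs, hsW⟩ := exists_betaClosure_trimmed_subset (hW₁.union hW₂)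
    (hsub.trans (union_subset_union hFW₁ hFW₂))
  have hA : ∀ q ∈ trimmed ε s.1, stoneCechUnit q ∈ W₁ ∪ W₂ :=
    fun q hq => hsW (subset_closure (mem_image_of_mem _ hq))
  have key : ∀ {U₁ U₂ E₁ E₂ : Set (StoneCech G.OneComplex)}, IsOpen U₁ → IsOpen U₂ →
      Disjoint U₁ U₂ → (∀ q ∈ trimmed ε s.1, stoneCechUnit q ∈ U₁ ∪ U₂) → E₂ ⊆ U₂ →
      tangleCore ε τ ⊆ E₁ ∪ E₂ →
      (∃ B, ({v | v ∉ s.1 ∧ stoneCechUnit (vertex v) ∈ U₁}ᶜ, B) ∈ τ.seps) →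
      tangleCore ε τ ⊆ E₁ := by
    rintro U₁ U₂ E₁ E₂ hU₁ hU₂ hdU hAU hE hcov ⟨B, hB⟩ x hx
    refine (hcov hx).resolve_right fun hx₂ => ?_
    have hx' := mem_tangleCore.1 hx _ hB
    refine closure_minimal (s := stoneCechUnit '' _) ?_ hU₂.isClosed_compl hx' (hE hx₂)
    refine Subset.trans ?_ hdU.subset_compl_right
    rintro _ ⟨q, hq, rfl⟩
    have hqs : q ∈ trimmed ε s.1 :=
      trimmed_antitone ε (subset_compl_comm.1 fun v hv => hv.1) hq
    cases q with
    | vertex v => exact (not_not.1 hq).2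
    | inner e t =>
      have hone : tail e ∈ {v | v ∉ s.1 ∧ stoneCechUnit (vertex v) ∈ U₁} ∨
          head e ∈ {v | v ∉ s.1 ∧ stoneCechUnit (vertex v) ∈ U₁} := by
        by_contra! hcon
        exact hq.1 hcon
      rw [inner_eq_edgeMap] at hqs ⊢
      rcases hone with h | h
      · exact stoneCechUnit_edgeMap_mem hε hU₁ hU₂ hdU hAU (s := 0)
          (by rw [edgeMap_zero]; exact h.1) hqs (by rw [edgeMap_zero]; exact h.2)
      · exact stoneCechUnit_edgeMap_mem hε hU₁ hU₂ hdU hAU (s := 1)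
          (by rw [edgeMap_one]; exact h.1) hqs (by rw [edgeMap_one]; exact h.2)
  have hdW : ∀ {x}, x ∈ W₁ → x ∈ W₂ → False := fun h h' => Set.disjoint_left.1 hd h h'
  have hor := τ.compl_mem_or hs
    (D₁ := {v | v ∉ s.1 ∧ stoneCechUnit (vertex v) ∈ W₁})
    (D₂ := {v | v ∉ s.1 ∧ stoneCechUnit (vertex v) ∈ W₂}) ?_ ?_ ?_
  · rcases hor with h | h
    · exact Or.inl (key hW₁ hW₂ hd hA hFW₂ hsub ⟨_, h⟩)
    · refine Or.inr (key hW₂ hW₁ hd.symm ?_ hFW₁ ?_ ⟨_, h⟩)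
      · rwa [union_comm]
      · rwa [union_comm]
  · ext v
    refine ⟨fun h => h.elim And.left And.left, fun hv => ?_⟩
    exact (hA (vertex v) hv).imp (fun h => ⟨hv, h⟩) fun h => ⟨hv, h⟩
  · exact Set.disjoint_left.2 fun v h h' => hdW h.2 h'.2
  · rintro a ⟨ha, ha'⟩ b ⟨hb, hb'⟩ hab
    let e : G.edgeSet := ⟨s(a, b), hab⟩
    have he : s(tail e, head e) = s(a, b) := mk_tail_head e
    rcases Sym2.eq_iff.1 he with ⟨h1, h2⟩ | ⟨h1, h2⟩
    · refine hdW (stoneCechUnit_edgeMap_mem hε hW₁ hW₂ hd hA (e := e) (s := 0) (t := 1)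
        ?_ ?_ ?_) (?_ : stoneCechUnit (edgeMap e 1) ∈ W₂) <;>
        simpa only [edgeMap_zero, edgeMap_one, h1, h2]
    · refine hdW (stoneCechUnit_edgeMap_mem hε hW₁ hW₂ hd hA (e := e) (s := 1) (t := 0)
        ?_ ?_ ?_) (?_ : stoneCechUnit (edgeMap e 0) ∈ W₂) <;>
        simpa only [edgeMap_zero, edgeMap_one, h1, h2]

end tangleCore

theorem mem_connectedComponentIn_of_remainderTangle_eq {p q : StoneCech G.OneComplex}
    (hp : p ∈ G.stoneCechRemainder) (hq : q ∈ G.stoneCechRemainder)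
    (h : remainderTangle p hp = remainderTangle q hq) :
    q ∈ connectedComponentIn G.stoneCechRemainder p := by
  obtain ⟨ε, hε, hP⟩ := exists_notMem_betaClosure_nearVertex (P := {p, q}) (by simp)
    (insert_subset hp (singleton_subset_iff.2 hq))
  have hpc := mem_tangleCore_remainderTangle hp (hP p (by simp))
  have hqc := mem_tangleCore_remainderTangle hq (hP q (by simp))
  rw [← h] at hqc
  exact (isPreconnected_tangleCore hε).subset_connectedComponentIn hpc
    (tangleCore_subset_remainder hε) hqc

open scoped Topology

/-! ### Basic open sets of the tangle compactification in terms of separations -/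

theorem mem_compVerts {X : Set V} {𝒞 : Set (G.ComponentCompl X)} {v : V} :
    v ∈ compVerts 𝒞 ↔ ∃ C ∈ 𝒞, v ∈ C := by
  simp only [compVerts, mem_iUnion, exists_prop, SetLike.mem_coe]

theorem isSeparation_sepTowards {X : Set V} (hX : X.Finite) (𝒞 : Set (G.ComponentCompl X)) :
    G.IsSeparation (sepTowards 𝒞) := by
  refine ⟨hX.subset ?_, eq_univ_of_forall fun v => ?_, ?_⟩
  · rintro v ⟨h, h' | h'⟩
    · exact h'
    · exact absurd h' h
  · by_cases h : v ∈ compVerts 𝒞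
    · exact Or.inr (Or.inr h)
    · exact Or.inl h
  · rintro a ⟨ha, ha'⟩ b ⟨-, hb⟩ hab
    obtain ⟨C, hC, hbC⟩ := mem_compVerts.1 (not_not.1 hb)
    exact ha (mem_compVerts.2
      ⟨C, hC, ComponentCompl.mem_of_adj b a hbC (fun h => ha' (Or.inl h)) hab.symm⟩)

theorem compPoints_union_crossingPoints {X : Set V} (𝒞 : Set (G.ComponentCompl X)) :
    TangleCompactification.compPoints 𝒞 ∪ TangleCompactification.crossingPoints 𝒞 =
      (subcomplex G (sepTowards 𝒞).1)ᶜ := by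
  have hends : ∀ q : G.OneComplex, q ∈ (subcomplex G (sepTowards 𝒞).1)ᶜ ↔
      ∃ v ∈ q.ends, v ∈ compVerts 𝒞 := fun q => by
    simp only [sepTowards, mem_compl_iff, mem_subcomplex, not_subset, not_not]
  ext q
  rw [hends]
  constructor
  · rintro (⟨C, hC, ⟨v, hv, rfl⟩ | ⟨e, t, he, rfl⟩⟩ | ⟨e, t, ⟨x, -, y, hy, he⟩, rfl⟩)
    · exact ⟨v, rfl, mem_compVerts.2 ⟨C, hC, hv⟩⟩
    · exact ⟨tail e, by simp, mem_compVerts.2 ⟨C, hC, he _ (mem_edge_iff.2 (Or.inl rfl))⟩⟩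
    · refine ⟨y, ?_, hy⟩
      change y ∈ (e : Sym2 V)
      rw [he]
      exact Sym2.mem_mk_right x y
  · rintro ⟨y, hy, hyC⟩
    obtain ⟨C, hC, hyC'⟩ := mem_compVerts.1 hyC
    cases q with
    | vertex v =>
      obtain rfl : y = v := hy
      exact Or.inl ⟨C, hC, Or.inl ⟨y, hyC', rfl⟩⟩
    | inner e t =>
      obtain ⟨x, hx⟩ := Sym2.mem_iff_exists.1 (hy : y ∈ (e : Sym2 V))
      by_cases hxX : x ∈ X
      · exact Or.inr ⟨e, t, ⟨x, hxX, y, hyC, hx.trans Sym2.eq_swap⟩, rfl⟩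
      · refine Or.inl ⟨C, hC, Or.inr ⟨e, t, fun v hv => ?_, rfl⟩⟩
        have hadj : G.Adj y x := by
          rw [← mem_edgeSet, ← hx]
          exact e.2
        rw [hx, Sym2.mem_iff] at hv
        rcases hv with rfl | rfl
        · exact hyC'
        · exact ComponentCompl.mem_of_adj y v hyC' hxX hadj

/-- Every separation of finite order is of the form `sepTowards 𝒞`. -/
theorem IsSeparation.exists_sepTowards_eq {s : Set V × Set V} (hs : G.IsSeparation s) :
    ∃ 𝒞 : Set (G.ComponentCompl (s.1 ∩ s.2)), sepTowards 𝒞 = s := by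
  obtain ⟨-, hu, hadj⟩ := hs
  have hsu : ∀ v, v ∈ s.1 ∨ v ∈ s.2 := fun v => by rw [← mem_union, hu]; trivial
  let 𝒞 : Set (G.ComponentCompl (s.1 ∩ s.2)) := {C | ∃ v ∈ C, v ∉ s.1}
  -- Walks avoiding the separator cannot enter the small side.
  have hwalk : ∀ v w : ((s.1 ∩ s.2)ᶜ : Set V), (v : V) ∉ s.1 →
      (G.induce (s.1 ∩ s.2)ᶜ).Reachable v w → (w : V) ∉ s.1 := by
    rintro v w hv ⟨p⟩
    induction p with
    | nil => exact hv
    | @cons a b c hab _ ih =>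
      refine ih fun hb => ?_
      have hb2 : (b : V) ∉ s.2 := fun h => b.2 ⟨hb, h⟩
      exact hadj b ⟨hb, hb2⟩ a ⟨(hsu a).resolve_left hv, hv⟩ (G.adj_symm hab)
  have hverts : compVerts 𝒞 = s.1ᶜ := by
    ext w
    rw [mem_compVerts]
    constructor
    · rintro ⟨C, ⟨v, ⟨hvX, hvC⟩, hv⟩, ⟨hwX, hwC⟩⟩
      exact hwalk ⟨v, hvX⟩ ⟨w, hwX⟩ hv (ConnectedComponent.eq.1 (hvC.trans hwC.symm))
    · intro hw
      have hwX : w ∉ s.1 ∩ s.2 := fun h => hw h.1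
      exact ⟨_, ⟨w, componentComplMk_mem G hwX, hw⟩, componentComplMk_mem G hwX⟩
  refine ⟨𝒞, Prod.ext ?_ ?_⟩
  · simp only [sepTowards, hverts, compl_compl]
  · simp only [sepTowards, hverts]
    ext v
    have := hsu v
    simp only [mem_union, mem_inter_iff, mem_compl_iff]
    tauto

theorem TangleCompactification.isOpen_ofPoint_image {U : Set G.OneComplex} (hU : IsOpen U) :
    IsOpen (ofPoint '' U : Set G.TangleCompactification) :=
  TopologicalSpace.isOpen_generateFrom_of_mem (Or.inl ⟨U, hU, rfl⟩)

theorem TangleCompactification.isOpen_of_isSeparation {s : Set V × Set V}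
    (hs : G.IsSeparation s) :
    IsOpen (ofPoint '' (subcomplex G s.1)ᶜ ∪ ofTangle '' {τ | s ∈ τ.seps} :
      Set G.TangleCompactification) := by
  obtain ⟨𝒞, h𝒞⟩ := hs.exists_sepTowards_eq
  refine TopologicalSpace.isOpen_generateFrom_of_mem (Or.inr ⟨s.1 ∩ s.2, hs.1, 𝒞, ?_⟩)
  rw [basicOpen, compPoints_union_crossingPoints, h𝒞]
  simp only [Tangle.bigSides, mem_ofPred_eq, h𝒞]

/-! ### The canonical map onto the tangle compactification -/

open TangleCompactification

open scoped Classical in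
/-- The map from the Stone-Čech compactification to the tangle compactification that is the
identity on the 1-complex and sends every point of the remainder to the tangle it induces. -/
def toTangleCompactification (p : StoneCech G.OneComplex) : G.TangleCompactification :=
  if h : p ∈ G.stoneCechImage then ofPoint h.choose else ofTangle (remainderTangle p h)

theorem toTangleCompactification_stoneCechUnit (q : G.OneComplex) :
    toTangleCompactification (stoneCechUnit q) = ofPoint q := by
  have h : (stoneCechUnit q : StoneCech G.OneComplex) ∈ G.stoneCechImage := mem_range_self q
  rw [toTangleCompactification, dif_pos h]
  exact congrArg ofPoint (isEmbedding_stoneCechUnit.injective h.choose_spec)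

theorem toTangleCompactification_of_mem_remainder {p : StoneCech G.OneComplex}
    (hp : p ∈ G.stoneCechRemainder) :
    toTangleCompactification p = ofTangle (remainderTangle p hp) :=
  dif_neg hp

theorem toTangleCompactification_of_mem_tangleCore {ε : G.edgeSet → ℝ}
    (hε : ∀ e, ε e ∈ Ioc (0 : ℝ) 1) {τ : G.Tangle} {p : StoneCech G.OneComplex}
    (hp : p ∈ tangleCore ε τ) : toTangleCompactification p = ofTangle τ := by
  have hp' := tangleCore_subset_remainder hε hp
  rw [toTangleCompactification_of_mem_remainder hp',
    ← eq_remainderTangle_of_mem_tangleCore hp' hp]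

theorem surjective_toTangleCompactification :
    Function.Surjective (toTangleCompactification (G := G)) := by
  rintro (q | τ)
  · exact ⟨_, toTangleCompactification_stoneCechUnit q⟩
  · obtain ⟨p, hp⟩ := tangleCore_nonempty (ε := fun _ => 1) (τ := τ)
    exact ⟨p, toTangleCompactification_of_mem_tangleCore (by simp) hp⟩

theorem toTangleCompactification_eq_iff {p q : StoneCech G.OneComplex} :
    toTangleCompactification p = toTangleCompactification q ↔ G.remainderSetoid p q := by
  constructor
  · intro h
    by_cases hp : p ∈ G.stoneCechImage <;> by_cases hq : q ∈ G.stoneCechImage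
    · obtain ⟨p, rfl⟩ := hp
      obtain ⟨q, rfl⟩ := hq
      rw [toTangleCompactification_stoneCechUnit, toTangleCompactification_stoneCechUnit] at h
      exact Or.inl (congrArg _ (Sum.inl_injective h))
    · obtain ⟨p, rfl⟩ := hp
      rw [toTangleCompactification_stoneCechUnit,
        toTangleCompactification_of_mem_remainder hq] at h
      exact absurd h Sum.inl_ne_inr
    · obtain ⟨q, rfl⟩ := hq
      rw [toTangleCompactification_stoneCechUnit,
        toTangleCompactification_of_mem_remainder hp] at h
      exact absurd h Sum.inr_ne_inl
    · rw [toTangleCompactification_of_mem_remainder hp,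
        toTangleCompactification_of_mem_remainder hq] at h
      exact Or.inr ⟨p, hp, mem_connectedComponentIn hp,
        mem_connectedComponentIn_of_remainderTangle_eq hp hq (Sum.inr_injective h)⟩
  · rintro (rfl | ⟨z, -, hpz, hqz⟩)
    · rfl
    · have hp := connectedComponentIn_subset _ _ hpz
      have hq := connectedComponentIn_subset _ _ hqz
      rw [toTangleCompactification_of_mem_remainder hp,
        toTangleCompactification_of_mem_remainder hq,
        remainderTangle_eq_of_mem_connectedComponentIn hp hq hpz hqz]

/-! ### Continuity -/

theorem isOpen_fineTopology_of_isOpen {W : Set (StoneCech G.OneComplex)} (hW : IsOpen W) :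
    IsOpen[G.fineTopology] W :=
  TopologicalSpace.isOpen_generateFrom_of_mem (Or.inl hW)

theorem isOpen_fineTopology_image {U : Set G.OneComplex} (hU : IsOpen U) :
    IsOpen[G.fineTopology] (stoneCechUnit '' U) := by
  obtain ⟨W, hW, rfl⟩ := isEmbedding_stoneCechUnit.isOpen_iff.1 hU
  rw [image_preimage_eq_inter_range]
  exact @IsOpen.inter _ G.fineTopology _ _ (isOpen_fineTopology_of_isOpen hW)
    (TopologicalSpace.isOpen_generateFrom_of_mem (Or.inr rfl))

theorem continuous_toTangleCompactification :
    Continuous[G.fineTopology, _] (toTangleCompactification (G := G)) := by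
  refine continuous_generateFrom_iff.2 ?_
  rintro _ (⟨U, hU, rfl⟩ | ⟨X, hX, 𝒞, rfl⟩)
  · convert isOpen_fineTopology_image hU
    ext p
    constructor
    · rintro ⟨q, hq, hqp⟩
      by_cases hp : p ∈ G.stoneCechImage
      · obtain ⟨p, rfl⟩ := hp
        rw [toTangleCompactification_stoneCechUnit] at hqp
        exact ⟨p, Sum.inl_injective hqp ▸ hq, rfl⟩
      · rw [toTangleCompactification_of_mem_remainder hp] at hqp
        exact absurd hqp Sum.inl_ne_inr
    · rintro ⟨q, hq, rfl⟩
      exact ⟨q, hq, (toTangleCompactification_stoneCechUnit q).symm⟩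
  · have hsep := isSeparation_sepTowards hX 𝒞
    convert isOpen_fineTopology_of_isOpen
      (isClosed_closure (s := stoneCechUnit '' subcomplex G (sepTowards 𝒞).1)).isOpen_compl
    ext p
    rw [mem_preimage, basicOpen, compPoints_union_crossingPoints, mem_compl_iff]
    by_cases hp : p ∈ G.stoneCechImage
    · obtain ⟨q, rfl⟩ := hp
      rw [toTangleCompactification_stoneCechUnit,
        stoneCechUnit_mem_betaClosure_iff (isClosed_subcomplex _)]
      constructor
      · rintro (⟨r, hr, hrq⟩ | ⟨τ, -, hτ⟩)
        · exact Sum.inl_injective hrq ▸ hr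
        · exact absurd hτ Sum.inr_ne_inl
      · exact fun h => Or.inl ⟨q, h, rfl⟩
    · rw [toTangleCompactification_of_mem_remainder hp,
        ← mem_remainderTangle_iff_notMem (hp := hp) hsep]
      constructor
      · rintro (⟨r, -, hr⟩ | ⟨τ, hτ, hτp⟩)
        · exact absurd hr Sum.inl_ne_inr
        · exact Sum.inr_injective hτp ▸ hτ
      · exact fun h => Or.inr ⟨_, h, rfl⟩

/-! ### Openness -/

theorem continuous_stoneCechUnit_fineTopology :
    Continuous[_, G.fineTopology] (stoneCechUnit : G.OneComplex → StoneCech G.OneComplex) := by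
  refine continuous_generateFrom_iff.2 ?_
  rintro U (hU | rfl)
  · exact hU.preimage continuous_stoneCechUnit
  · rw [stoneCechImage, preimage_range]
    exact isOpen_univ

/-- On the remainder, the fine topology has the same neighbourhoods as the Stone-Čech
compactification. -/
theorem inter_remainder_subset_interior {W : Set (StoneCech G.OneComplex)}
    (hW : IsOpen[G.fineTopology] W) : W ∩ G.stoneCechRemainder ⊆ interior W := by
  induction hW with
  | basic U hU =>
    rcases hU with hU | rfl
    · rw [IsOpen.interior_eq (s := U) hU]
      exact inter_subset_left
    · exact fun x hx => absurd hx.1 hx.2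
  | univ => simp
  | inter U U' _ _ ih ih' =>
    rw [interior_inter]
    exact fun x hx => ⟨ih ⟨hx.1.1, hx.2⟩, ih' ⟨hx.1.2, hx.2⟩⟩
  | sUnion S _ ih =>
    rintro x ⟨⟨U, hU, hxU⟩, hx⟩
    exact interior_mono (subset_sUnion_of_mem hU) (ih U hU ⟨hxU, hx⟩)

/-- A saturated set `W` that is open in the fine topology and contains the points inducing a tangle
contains all points of the 1-complex outside the small side of some separation in the tangle. For
otherwise one point missing from `W` can be chosen on every edge that is not contained in `W`;
these form a closed discrete set with all its subsets closed, and its limit points in the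
remainder along the tangle again induce the tangle, yet lie outside the interior of `W`. -/
theorem exists_compl_subcomplex_subset {W : Set (StoneCech G.OneComplex)}
    (hW : IsOpen[G.fineTopology] W)
    (hsat : ∀ p ∈ W, ∀ q, toTangleCompactification p = toTangleCompactification q → q ∈ W)
    {p : StoneCech G.OneComplex} (hp : p ∈ G.stoneCechRemainder) (hpW : p ∈ W) :
    ∃ s ∈ (remainderTangle p hp).seps, ∀ q ∈ (subcomplex G s.1)ᶜ, stoneCechUnit q ∈ W := by
  have hc : ∀ e : G.edgeSet, ∃ c : Ioo (0 : ℝ) 1, ∀ t : Ioo (0 : ℝ) 1,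
      stoneCechUnit (inner e t) ∉ W → stoneCechUnit (inner e c) ∉ W := by
    intro e
    by_cases h : ∃ t : Ioo (0 : ℝ) 1, stoneCechUnit (inner e t) ∉ W
    · obtain ⟨c, hc⟩ := h
      exact ⟨c, fun _ _ => hc⟩
    · push Not at h
      exact ⟨⟨1 / 2, by norm_num, by norm_num⟩, fun t ht => absurd (h t) ht⟩
  choose c hc using hc
  let S : Set G.OneComplex :=
    {q | stoneCechUnit q ∉ W ∧ ∀ (e : G.edgeSet) (t : Ioo (0 : ℝ) 1), q = inner e t → t = c e}
  have hSc : ∀ T ⊆ S, IsClosed T := by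
    intro T hT
    refine isClosed_of_finite_preimage fun e => ?_
    refine (((finite_singleton ⟨c e, Ioo_subset_Icc_self (c e).2⟩).insert 1).insert 0).subset ?_
    intro t ht
    rcases eq_zero_or_one_or_mem_Ioo t with rfl | rfl | ht'
    · simp
    · simp
    · have h := (hT ht).2 e _ (edgeMap_of_mem e ht')
      have h' : (t : ℝ) = c e := congrArg Subtype.val h
      exact Or.inr (Or.inr (Subtype.ext h'))
  obtain ⟨s, hs, hsS⟩ := exists_subset_of_iInter_subset (remainderTangle p hp)
    (F := fun A => betaClosure (S \ subcomplex G A))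
    (fun A B h => betaClosure_mono (sdiff_subset_sdiff_right (subcomplex_mono h)))
    (fun A => isClosed_closure) isOpen_empty (by
      intro x hx
      by_cases hxr : x ∈ G.stoneCechImage
      · obtain ⟨q, rfl⟩ := hxr
        have h := hx _ ((remainderTangle p hp).finite_univ_mem q.finite_ends)
        rw [stoneCechUnit_mem_betaClosure_iff (hSc _ sdiff_subset)] at h
        exact h.2 Subset.rfl
      · have heq : remainderTangle p hp = remainderTangle x hxr := by
          refine eq_remainderTangle hxr fun s hs => betaClosure_mono ?_ (hx s hs)
          exact fun q hq => (hs.1.subset_or_subset q).resolve_left hq.2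
        have hxW : x ∈ W := hsat p hpW x (by
          rw [toTangleCompactification_of_mem_remainder hp,
            toTangleCompactification_of_mem_remainder hxr, heq])
        obtain ⟨_, h1, ⟨q, hq, rfl⟩⟩ := mem_closure_iff.1
          (hx _ ((remainderTangle p hp).finite_univ_mem finite_empty)) (interior W)
          isOpen_interior (inter_remainder_subset_interior hW ⟨hxW, hxr⟩)
        exact hq.1.1 (interior_subset h1))
  refine ⟨s, hs, fun q hq => ?_⟩
  by_contra hqW
  have hS : ∀ r ∈ S, r ∉ subcomplex G s.1 → False := fun r hr hrs =>
    hsS (subset_closure (mem_image_of_mem _ ⟨hr, hrs⟩))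
  cases q with
  | vertex v => exact hS _ ⟨hqW, by simp⟩ hq
  | inner e t =>
    refine hS (inner e (c e)) ⟨hc e t hqW, ?_⟩ hq
    intro e' t' h
    obtain ⟨rfl, rfl⟩ := OneComplex.inner.inj h
    rfl

theorem isOpen_toTangleCompactification_image {W : Set (StoneCech G.OneComplex)}
    (hW : IsOpen[G.fineTopology] W)
    (hsat : ∀ p ∈ W, ∀ q, toTangleCompactification p = toTangleCompactification q → q ∈ W) :
    IsOpen (toTangleCompactification '' W) := by
  rw [isOpen_iff_forall_mem_open]
  rintro _ ⟨p, hpW, rfl⟩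
  by_cases hp : p ∈ G.stoneCechImage
  · obtain ⟨q, rfl⟩ := hp
    refine ⟨_, ?_, isOpen_ofPoint_image
      (@Continuous.isOpen_preimage _ _ _ G.fineTopology _ continuous_stoneCechUnit_fineTopology _ hW),
      ⟨q, hpW, (toTangleCompactification_stoneCechUnit q).symm⟩⟩
    rintro _ ⟨r, hr, rfl⟩
    exact ⟨_, hr, toTangleCompactification_stoneCechUnit r⟩
  · have hε : ∀ e : G.edgeSet, (fun _ => 1 : G.edgeSet → ℝ) e ∈ Ioc (0 : ℝ) 1 := by simp
    obtain ⟨s, hs, hsW⟩ := exists_compl_subcomplex_subset hW hsat hp hpW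
    obtain ⟨t, ht, htW⟩ := exists_betaClosure_trimmed_subset (ε := fun _ => 1)
      (τ := remainderTangle p hp) (isOpen_interior (s := W)) (by
        intro x hx
        refine inter_remainder_subset_interior hW ⟨hsat p hpW x ?_,
          tangleCore_subset_remainder hε hx⟩
        rw [toTangleCompactification_of_mem_tangleCore hε hx,
          toTangleCompactification_of_mem_remainder hp])
    have hst := (remainderTangle p hp).sup_mem hs ht
    refine ⟨_, ?_, isOpen_of_isSeparation hst.1, ?_⟩
    · rintro _ (⟨q, hq, rfl⟩ | ⟨σ, hσ, rfl⟩)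
      · exact ⟨_, hsW q fun h => hq (subcomplex_mono subset_union_left h),
          toTangleCompactification_stoneCechUnit q⟩
      · obtain ⟨x, hx⟩ := tangleCore_nonempty (ε := fun _ => 1) (τ := σ)
        have htσ : t ∈ σ.seps := σ.mem_of_le ht.1 hσ ⟨subset_union_right, inter_subset_right⟩
        exact ⟨x, interior_subset (htW (mem_tangleCore.1 hx t htσ)),
          toTangleCompactification_of_mem_tangleCore hε hx⟩
    · rw [toTangleCompactification_of_mem_remainder hp]
      exact Or.inr ⟨_, hst, rfl⟩

variable (G) in
/-- The bijection between the quotient and the tangle compactification that is induced by the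
canonical map. -/
def quotientEquiv : G.StoneCechQuotient ≃ G.TangleCompactification :=
  Equiv.ofBijective
    (Quotient.lift toTangleCompactification fun _ _ h => toTangleCompactification_eq_iff.2 h)
    ⟨by
      rintro ⟨p⟩ ⟨q⟩ h
      exact Quotient.sound (toTangleCompactification_eq_iff.1 h),
    fun y => (surjective_toTangleCompactification y).imp' (Quotient.mk _) fun _ h => h⟩

variable (G) in
/-- The homeomorphism between the quotient and the tangle compactification. -/
def quotientHomeomorph : G.StoneCechQuotient ≃ₜ G.TangleCompactification :=
  (quotientEquiv G).toHomeomorphOfContinuousOpen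
    (continuous_coinduced_dom.2 continuous_toTangleCompactification) (by
      intro U hU
      have hU' : IsOpen[G.fineTopology] (Quotient.mk G.remainderSetoid ⁻¹' U) := hU
      convert isOpen_toTangleCompactification_image hU' ?_
      · ext y
        constructor
        · rintro ⟨⟨p⟩, hp, rfl⟩
          exact ⟨p, hp, rfl⟩
        · rintro ⟨p, hp, rfl⟩
          exact ⟨_, hp, rfl⟩
      · intro p hp q h
        have : Quotient.mk G.remainderSetoid p = Quotient.mk G.remainderSetoid q :=
          Quotient.sound (toTangleCompactification_eq_iff.1 h)
        exact (congrArg (· ∈ U) this).mp hp)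

end SimpleGraph

end

/-- For every graph `G`, the tangle compactification of `G` is homeomorphic, by a homeomorphism that
is the identity on the 1-complex of `G`, to the space obtained from the Stone-Čech compactification
of the 1-complex by first declaring the 1-complex to be open and then collapsing each connected
component of the remainder to a single point. -/
theorem theorem1 {V : Type*} (G : SimpleGraph V) :
    ∃ Ψ : G.StoneCechQuotient ≃ₜ G.TangleCompactification,
      ∀ p : G.OneComplex,
        Ψ (SimpleGraph.StoneCechQuotient.ofPoint p) =
          SimpleGraph.TangleCompactification.ofPoint p :=
  ⟨SimpleGraph.quotientHomeomorph G, SimpleGraph.toTangleCompactification_stoneCechUnit⟩
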